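/- Let $E$ be a complex Banach lattice with real part $E_{\mathbb R}$, i.e. $E$ is the complexification of the real Banach lattice $E_{\mathbb R}$, with modulus $|x+iy|=\sup_{\theta\in\mathbb R}\big((\cos\theta)x+(\sin\theta)y\big)\in E_{\mathbb R}$ for $x,y\in E_{\mathbb R}$ and norm satisfying $\|z\|=\|\,|z|\,\|$. For $v,w\in E_{\mathbb R}$ write $v\succeq w$ (equivalently $w\preceq v$) if there is a constant $c>0$ with $v\ge cw$, and for $0\le u\in E$ let $E_u=\{x\in E:|x|\preceq u\}$. A linear operator $A:E\supseteq D(A)\to E$ is called real if $D(A)$ is spanned by $D(A)\cap E_{\mathbb R}$ and $A$ maps $D(A)\cap E_{\mathbb R}$ into $E_{\mathbb R}$. Write $\rho(A)$ for its resolvent set and $R(\lambda,A)=(\lambda-A)^{-1}$ for $\lambda\in\rho(A)$. Let $A$ and $B$ be closed, densely defined, real operators on $E$, let $0\le u\in E$, and let $\lambda_0\in\mathbb R$ be a spectral value of $B$ and a pole of the resolvent $R(\cdot,B)$. Let $P=\frac1{2\pi i}\oint R(\lambda,B)\,d\lambda$ (integral over a positively oriented circle centred at $\lambda_0$ such that the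 closed disc it bounds contains no other spectral value of $B$) be the spectral projection of $B$ associated with $\lambda_0$. Assume that (a) $D(A)\subseteq E_u$ and $D(B)\subseteq E_u$; (b) $Pf\succeq u$ for every $f\in E$ with $f\ge 0$ and $f\ne0$. If $\lambda_0\in\rho(A)$, then for each $0\ne f\in E$ there is $\delta>0$ (depending on $f$) such that every $\lambda\in(\lambda_0,\lambda_0+\delta)$ and every $\mu\in(\lambda_0-\delta,\lambda_0)$ lie in $\rho(A)\cap\rho(B)$ and $$R(\lambda,B)|f|-|R(\lambda,A)f|\succeq u\qquad\text{and}\qquad R(\mu,B)|f|+|R(\mu,A)f|\preceq -u .$$ -/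

import Mathlib

open Set Filter Topology

noncomputable section

/-- `ComplexBanachLattice X E` says that the complex Banach space `E` is a complex Banach lattice
with real part (isomorphic to) the real Banach lattice `X`: as a vector space `E` is the
complexification of `X`, the modulus of `z = x + i y` is the supremum of
`(cos θ) x + (sin θ) y` over all real `θ`, taken in `X`, and `‖z‖` is the norm of the modulus
of `z`. -/
class ComplexBanachLattice (X E : Type*)
    [NormedAddCommGroup X] [Lattice X] [IsOrderedAddMonoid X] [HasSolidNorm X]
    [NormedSpace ℝ X] [IsOrderedModule ℝ X] [CompleteSpace X]
    [NormedAddCommGroup E] [NormedSpace ℂ E] [CompleteSpace E] where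
  /-- The embedding of the real part into `E`. -/
  ofReal : X →ₗ[ℝ] E
  /-- Every vector is `x + i y` for unique real vectors `x` and `y`. -/
  existsUnique_re_im : ∀ z : E, ∃! p : X × X, z = ofReal p.1 + Complex.I • ofReal p.2
  /-- The modulus of a vector. -/
  modulus : E → X
  isLUB_modulus : ∀ x y : X,
    IsLUB (range fun θ : ℝ => Real.cos θ • x + Real.sin θ • y)
      (modulus (ofReal x + Complex.I • ofReal y))
  norm_eq_norm_modulus : ∀ z : E, ‖z‖ = ‖modulus z‖

namespace ComplexBanachLattice

variable (X : Type*) {E : Type*}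
  [NormedAddCommGroup X] [Lattice X] [IsOrderedAddMonoid X] [HasSolidNorm X]
  [NormedSpace ℝ X] [IsOrderedModule ℝ X] [CompleteSpace X]
  [NormedAddCommGroup E] [NormedSpace ℂ E] [CompleteSpace E] [ComplexBanachLattice X E]

/-- The real part of `E`, as a subset of `E`. -/
def realPart (E : Type*) [NormedAddCommGroup E] [NormedSpace ℂ E] [CompleteSpace E]
    [ComplexBanachLattice X E] : Set E :=
  range (ofReal : X →ₗ[ℝ] E)

/-- The modulus `|z|`, as an element of `E`. -/
def abs (z : E) : E := (ofReal : X →ₗ[ℝ] E) (modulus z)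

/-- `z ≤ w` for vectors in the real part of `E`. -/
def RealLE (z w : E) : Prop :=
  ∃ x y : X, z = ofReal x ∧ w = ofReal y ∧ x ≤ y

/-- `z ≽ w` for vectors in the real part of `E`: there is a constant `c > 0` with `z ≥ c w`. -/
def Succeq (z w : E) : Prop :=
  z ∈ realPart X E ∧ w ∈ realPart X E ∧ ∃ c : ℝ, 0 < c ∧ RealLE X (c • w) z

/-- `z ≼ w` means `w ≽ z`. -/
def Preceq (z w : E) : Prop := Succeq X w z

/-- The principal ideal `E_u = {z : |z| ≼ u}`. -/
def principalIdeal (u : E) : Set E := {z | Preceq X (abs X z) u}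

/-- An operator is real if its domain is spanned by the real vectors in it, and it maps
these real vectors to real vectors. -/
def IsRealOperator (A : E →ₗ.[ℂ] E) : Prop :=
  Submodule.span ℂ ((A.domain : Set E) ∩ realPart X E) = A.domain ∧
    ∀ z : A.domain, (z : E) ∈ realPart X E → A z ∈ realPart X E

end ComplexBanachLattice

namespace LinearPMap

variable {E : Type*} [NormedAddCommGroup E] [NormedSpace ℂ E]

/-- The bounded operator `R` on `E` is a two-sided inverse of `l - A : D(A) → E`. -/
def IsResolventAt (A : E →ₗ.[ℂ] E) (l : ℂ) (R : E →L[ℂ] E) : Prop :=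
  (∀ z : E, ∃ h : R z ∈ A.domain, l • R z - A ⟨R z, h⟩ = z) ∧
    ∀ z : A.domain, R (l • (z : E) - A z) = z

/-- The resolvent set `ρ(A)`. -/
def resolventSet (A : E →ₗ.[ℂ] E) : Set ℂ := {l | ∃ R : E →L[ℂ] E, A.IsResolventAt l R}

/-- The spectrum `σ(A)`. -/
def spectrum (A : E →ₗ.[ℂ] E) : Set ℂ := A.resolventSetᶜ

open Classical in
/-- The resolvent `R(l, A) = (l - A)⁻¹` for `l ∈ ρ(A)` (and `0` for other `l`). -/
def resolvent (A : E →ₗ.[ℂ] E) (l : ℂ) : E →L[ℂ] E :=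
  if h : ∃ R : E →L[ℂ] E, A.IsResolventAt l R then h.choose else 0

/-- `l₀` is a pole of `R(·, A)`: an isolated singularity at which the resolvent is meromorphic
with negative order. -/
def IsPoleOfResolvent (A : E →ₗ.[ℂ] E) (l₀ : ℂ) : Prop :=
  (∀ᶠ l in 𝓝[≠] l₀, l ∈ A.resolventSet) ∧
    MeromorphicAt A.resolvent l₀ ∧ meromorphicOrderAt A.resolvent l₀ < 0

/-- `P` is the spectral projection of `A` associated with the isolated point `l₀` of the
spectrum: `P = (2πi)⁻¹ ∮ R(l, A) dl` over a positively oriented circle around `l₀` such that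
the closed disc bounded by it contains no spectral value other than `l₀`. -/
def IsSpectralProjection (A : E →ₗ.[ℂ] E) (l₀ : ℂ) (P : E →L[ℂ] E) : Prop :=
  ∃ r : ℝ, 0 < r ∧ Metric.closedBall l₀ r \ {l₀} ⊆ A.resolventSet ∧
    P = (2 * Real.pi * Complex.I : ℂ)⁻¹ • ∮ l in C(l₀, r), A.resolvent l

end LinearPMap

end

/-! Near `l₀` the resolvent of `B` behaves like `(l - l₀)⁻¹ P`, and every other term is bounded by a
multiple of `u`.

The pole is simple. The range of `P` lies in `D(B)`, hence in `E_u`. Put `w = P u`, so `w ≽ u`. For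
a real fixed vector `x` of `P`, take the largest `t` with `t w ≤ x`. If `x ≠ t w`, then `x - t w = P
(x - t w) ≽ u ≽ w`, contradicting maximality. So `P` has rank one (`eq_smul_of_fixed`). The Laurent
coefficients satisfy `(B - l₀) Q k = Q (k + 1)` and `P Q k = Q k` (`exists_laurent`). Thus `B - l₀`
acts on the range of `P` as a nilpotent scalar, that is, as zero.

Norm bounds become bounds by `u`: an operator with range in `E_u` is bounded for the gauge of `u`,
by Baire (`exists_modulus_le_of_range_subset`). This controls both `R(l, A) f` and the regular part
of `R(l, B) |f|`. Since `P |f| ≥ c u`, the term `(l - l₀)⁻¹ P |f|` dominates close to `l₀`, with the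
sign of `l - l₀`. -/

namespace ComplexBanachLattice

variable {X E : Type*}
  [NormedAddCommGroup X] [Lattice X] [IsOrderedAddMonoid X] [HasSolidNorm X]
  [NormedSpace ℝ X] [IsOrderedModule ℝ X] [CompleteSpace X]
  [NormedAddCommGroup E] [NormedSpace ℂ E] [CompleteSpace E] [ComplexBanachLattice X E]

/-! ### Complexification, modulus and principal ideals. -/

theorem mk_inj {x y x' y' : X}
    (h : (ofReal x : E) + Complex.I • ofReal y = ofReal x' + Complex.I • ofReal y') :
    x = x' ∧ y = y' := by
  have := (existsUnique_re_im (X := X) ((ofReal x : E) + Complex.I • ofReal y)).unique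
    (y₁ := (x, y)) (y₂ := (x', y')) rfl h
  simpa using this

theorem ofReal_injective : Function.Injective (ofReal : X →ₗ[ℝ] E) := by
  intro x y h
  exact (mk_inj (E := E) (x := x) (x' := y) (y := 0) (y' := 0) (by rw [h])).1

variable (X E) in
/-- The real linear isomorphism `(x, y) ↦ x + i y` of `X × X` onto `E`. -/
noncomputable def mkEquiv : (X × X) ≃ₗ[ℝ] E :=
  LinearEquiv.ofBijective (ofReal.coprod (Complex.I • ofReal))
    ⟨fun _ _ h => Prod.ext_iff.2 (mk_inj (E := E) (by simpa using h)), fun z => by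
      obtain ⟨p, hp⟩ := (existsUnique_re_im (X := X) z).exists
      exact ⟨p, by simpa using hp.symm⟩⟩

variable (X) in
/-- The real part of a vector. -/
noncomputable def re : E →ₗ[ℝ] X := LinearMap.fst ℝ X X ∘ₗ (mkEquiv X E).symm.toLinearMap

variable (X) in
/-- The imaginary part of a vector. -/
noncomputable def im : E →ₗ[ℝ] X := LinearMap.snd ℝ X X ∘ₗ (mkEquiv X E).symm.toLinearMap

theorem re_add_im (z : E) : (ofReal (re X z) : E) + Complex.I • ofReal (im X z) = z :=
  (mkEquiv X E).apply_symm_apply z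

theorem re_mk (x y : X) : re X ((ofReal x : E) + Complex.I • ofReal y) = x :=
  (mk_inj (re_add_im _)).1

theorem im_mk (x y : X) : im X ((ofReal x : E) + Complex.I • ofReal y) = y :=
  (mk_inj (re_add_im _)).2

@[simp]
theorem re_ofReal (x : X) : re X (ofReal x : E) = x := by
  simpa using re_mk (E := E) x 0

@[simp]
theorem im_ofReal (x : X) : im X (ofReal x : E) = 0 := by
  simpa using im_mk (E := E) x 0

theorem ofReal_re_of_im_eq_zero {z : E} (h : im X z = 0) : (ofReal (re X z) : E) = z := by
  simpa [h] using re_add_im (X := X) z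

theorem smul_eq_mk (c : ℂ) (z : E) : c • z =
    (ofReal (c.re • re X z - c.im • im X z) : E)
      + Complex.I • ofReal (c.re • im X z + c.im • re X z) := by
  conv_lhs => rw [← re_add_im (X := X) z, ← Complex.re_add_im c]
  simp only [map_add, map_sub, map_smul, ← Complex.coe_smul]
  match_scalars
  · ring
  · ring_nf
    simp only [Complex.I_sq]
    ring

theorem re_smul (c : ℂ) (z : E) : re X (c • z) = c.re • re X z - c.im • im X z := by
  rw [smul_eq_mk (X := X), re_mk]

theorem im_smul (c : ℂ) (z : E) : im X (c • z) = c.re • im X z + c.im • re X z := by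
  rw [smul_eq_mk (X := X), im_mk]

theorem modulus_le_iff {z : E} {v : X} :
    modulus z ≤ v ↔ ∀ θ : ℝ, Real.cos θ • re X z + Real.sin θ • im X z ≤ v := by
  have h := isLUB_modulus (E := E) (re X z) (im X z)
  rw [re_add_im] at h
  rw [isLUB_le_iff h]
  simp [upperBounds]

theorem re_le_modulus (z : E) : re X z ≤ modulus z := by
  simpa using modulus_le_iff.1 (le_refl (modulus z : X)) 0

theorem neg_re_le_modulus (z : E) : -re X z ≤ modulus z := by
  simpa using modulus_le_iff.1 (le_refl (modulus z : X)) Real.pi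

theorem im_le_modulus (z : E) : im X z ≤ modulus z := by
  simpa using modulus_le_iff.1 (le_refl (modulus z : X)) (Real.pi / 2)

theorem neg_im_le_modulus (z : E) : -im X z ≤ modulus z := by
  simpa using modulus_le_iff.1 (le_refl (modulus z : X)) (-(Real.pi / 2))

theorem abs_re_le_modulus (z : E) : |re X z| ≤ modulus z :=
  abs_le'.2 ⟨re_le_modulus z, neg_re_le_modulus z⟩

theorem abs_im_le_modulus (z : E) : |im X z| ≤ modulus z :=
  abs_le'.2 ⟨im_le_modulus z, neg_im_le_modulus z⟩

theorem modulus_nonneg (z : E) : (0 : X) ≤ modulus z :=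
  (abs_nonneg _).trans (abs_re_le_modulus z)

theorem norm_le_norm_of_abs_le_modulus {x : X} {z : E} (h : |x| ≤ modulus z) : ‖x‖ ≤ ‖z‖ := by
  rw [norm_eq_norm_modulus (X := X) z]
  exact norm_le_norm_of_abs_le_abs (h.trans (le_abs_self _))

theorem continuous_re : Continuous (re X : E → X) :=
  AddMonoidHomClass.continuous_of_bound (re X : E →ₗ[ℝ] X) 1 fun z => by
    simpa using norm_le_norm_of_abs_le_modulus (abs_re_le_modulus z)

theorem continuous_im : Continuous (im X : E → X) :=
  AddMonoidHomClass.continuous_of_bound (im X : E →ₗ[ℝ] X) 1 fun z => by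
    simpa using norm_le_norm_of_abs_le_modulus (abs_im_le_modulus z)

theorem modulus_eq_zero_iff {z : E} : (modulus z : X) = 0 ↔ z = 0 := by
  rw [← norm_eq_zero, ← norm_eq_norm_modulus, norm_eq_zero]

/-- An intersection of closed conditions, one for each angle `θ`; continuity of the modulus is not
required. These are the closed sets of the Baire argument. -/
theorem isClosed_modulus_le (v : X) : IsClosed {z : E | modulus z ≤ v} := by
  simp only [modulus_le_iff, ofPred_forall]
  refine isClosed_iInter fun θ => isClosed_le ?_ continuous_const
  exact (continuous_re.const_smul _).add (continuous_im.const_smul _)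

theorem modulus_add_le {z w : E} {v v' : X} (hz : modulus z ≤ v) (hw : modulus w ≤ v') :
    modulus (z + w) ≤ v + v' := by
  rw [modulus_le_iff] at *
  intro θ
  convert add_le_add (hz θ) (hw θ) using 1
  simp only [map_add, smul_add]
  abel

theorem modulus_neg_le {z : E} {v : X} (hz : modulus z ≤ v) : modulus (-z) ≤ v := by
  rw [modulus_le_iff] at *
  intro θ
  simpa using hz (θ + Real.pi)

theorem modulus_smul_le {z : E} {v : X} (hz : modulus z ≤ v) {t : ℝ} (ht : 0 ≤ t) :
    modulus (t • z) ≤ t • v := by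
  rw [modulus_le_iff] at *
  intro θ
  convert smul_le_smul_of_nonneg_left (hz θ) ht using 1
  simp only [map_smul, smul_add, smul_comm t]

theorem realLE_iff {x y : X} : RealLE X (ofReal x : E) (ofReal y) ↔ x ≤ y := by
  constructor
  · rintro ⟨a, b, ha, hb, h⟩
    rwa [ofReal_injective ha, ofReal_injective hb]
  · exact fun h => ⟨x, y, rfl, rfl, h⟩

theorem succeq_ofReal_iff {x y : X} :
    Succeq X (ofReal x : E) (ofReal y) ↔ ∃ c : ℝ, 0 < c ∧ c • y ≤ x := by
  simp only [Succeq, ← map_smul, realLE_iff]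
  exact ⟨fun h => h.2.2, fun h => ⟨⟨x, rfl⟩, ⟨y, rfl⟩, h⟩⟩

theorem mem_principalIdeal_iff {u : X} (hu : 0 ≤ u) {z : E} :
    z ∈ principalIdeal X (ofReal u : E) ↔ ∃ n : ℕ, modulus z ≤ (n : ℝ) • u := by
  change Succeq X _ (abs X z) ↔ _
  rw [abs, succeq_ofReal_iff]
  constructor
  · rintro ⟨c, hc, h⟩
    obtain ⟨n, hn⟩ := exists_nat_ge c⁻¹
    refine ⟨n, le_trans ?_ (smul_le_smul_of_nonneg_right hn hu)⟩
    have := smul_le_smul_of_nonneg_left h (inv_nonneg.2 hc.le)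
    rwa [inv_smul_smul₀ hc.ne'] at this
  · rintro ⟨n, h⟩
    -- `n` may be `0`, so `n + 1` is inverted.
    refine ⟨((n : ℝ) + 1)⁻¹, by positivity, ?_⟩
    rw [inv_smul_le_iff_of_pos (by positivity)]
    exact h.trans (smul_le_smul_of_nonneg_right (by linarith) hu)

/-- A bounded operator with range in the principal ideal `E_u` is bounded for the gauge norm. -/
theorem exists_modulus_le_of_range_subset {u : X} (hu : 0 ≤ u) (T : E →L[ℂ] E)
    (hT : ∀ z, T z ∈ principalIdeal X (ofReal u : E)) :
    ∃ C : ℝ, 0 ≤ C ∧ ∀ z, modulus (T z) ≤ (C * ‖z‖) • u := by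
  -- Baire: the closed sets `{z | |T z| ≤ n u}` cover `E`, so one contains a ball; subtracting its
  -- centre gives the bound `2n` near `0`.
  obtain ⟨n, z₀, hz₀⟩ := nonempty_interior_of_iUnion_of_closed
    (f := fun n : ℕ => T ⁻¹' {z : E | modulus z ≤ (n : ℝ) • u})
    (fun n => (isClosed_modulus_le _).preimage T.continuous)
    (iUnion_eq_univ_iff.2 fun z => (mem_principalIdeal_iff hu).1 (hT z))
  obtain ⟨r, hr, hball⟩ := Metric.mem_nhds_iff.1 (mem_interior_iff_mem_nhds.1 hz₀)
  have key : ∀ z, ‖z‖ < r → modulus (T z) ≤ (2 * n : ℝ) • u := by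
    intro z hz
    have h1 : modulus (T (z₀ + z)) ≤ (n : ℝ) • u := hball (by simpa using hz)
    have h2 : modulus (T z₀) ≤ (n : ℝ) • u := hball (Metric.mem_ball_self hr)
    have := modulus_add_le h1 (modulus_neg_le h2)
    rw [← map_neg, ← map_add, ← add_smul, add_neg_cancel_comm] at this
    rwa [two_mul]
  -- The factor `2 / r` comes from rescaling `z` to norm `r / 2`.
  refine ⟨2 * n * (2 / r), by positivity, fun z => ?_⟩
  rcases eq_or_ne z 0 with rfl | hz
  · simpa using (modulus_eq_zero_iff (X := X).2 (rfl : (0 : E) = 0)).le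
  have hz' : 0 < ‖z‖ := norm_pos_iff.2 hz
  have h := modulus_smul_le (key ((r / (2 * ‖z‖)) • z) ?_) (t := 2 * ‖z‖ / r) (by positivity)
  · rw [T.map_smul_of_tower, smul_smul, smul_smul] at h
    convert h using 2
    · rw [show 2 * ‖z‖ / r * (r / (2 * ‖z‖)) = 1 by field_simp, one_smul]
    · ring
  · rw [norm_smul, Real.norm_of_nonneg (by positivity)]
    rw [show r / (2 * ‖z‖) * ‖z‖ = r / 2 by field_simp]
    linarith

theorem IsRealOperator.ofReal_mem_domain {A : E →ₗ.[ℂ] E} (hA : IsRealOperator X A) {z : E}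
    (hz : z ∈ A.domain) :
    (ofReal (re X z) : E) ∈ A.domain ∧ (ofReal (im X z) : E) ∈ A.domain := by
  rw [← hA.1] at hz
  induction hz using Submodule.span_induction with
  | mem x hx =>
    obtain ⟨hx, y, rfl⟩ := hx
    simpa using hx
  | zero => simp
  | add x y _ _ hx hy => simpa using ⟨add_mem hx.1 hy.1, add_mem hx.2 hy.2⟩
  | smul c x _ hx =>
    have h (t : ℝ) {y : E} (hy : y ∈ A.domain) : t • y ∈ A.domain := by
      rw [← Complex.coe_smul]
      exact A.domain.smul_mem _ hy
    rw [re_smul, im_smul, map_sub, map_add]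
    simp only [map_smul]
    exact ⟨sub_mem (h _ hx.1) (h _ hx.2), add_mem (h _ hx.2) (h _ hx.1)⟩

/-- `A z = A (re z) + i A (im z)` with both images real, so uniqueness of the decomposition
identifies them. This makes resolvents at real points real. -/
theorem IsRealOperator.ofReal_mem_graph {A : E →ₗ.[ℂ] E} (hA : IsRealOperator X A) {z w : E}
    (hz : (z, w) ∈ A.graph) :
    ((ofReal (re X z) : E), (ofReal (re X w) : E)) ∈ A.graph ∧
      ((ofReal (im X z) : E), (ofReal (im X w) : E)) ∈ A.graph := by
  have hd := hA.ofReal_mem_domain (A.mem_domain_of_mem_graph hz)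
  obtain ⟨a, ha⟩ := hA.2 ⟨_, hd.1⟩ ⟨_, rfl⟩
  obtain ⟨b, hb⟩ := hA.2 ⟨_, hd.2⟩ ⟨_, rfl⟩
  have h1 := A.mem_graph ⟨_, hd.1⟩
  have h2 := A.mem_graph ⟨_, hd.2⟩
  rw [← ha] at h1
  rw [← hb] at h2
  have h3 := add_mem h1 (A.graph.smul_mem Complex.I h2)
  simp only [Prod.smul_mk, Prod.mk_add_mk, re_add_im] at h3
  obtain rfl : (ofReal a : E) + Complex.I • ofReal b = w := A.mem_graph_snd_inj h3 hz rfl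
  rw [re_mk, im_mk]
  exact ⟨h1, h2⟩

end ComplexBanachLattice


/-! ### Taylor and Laurent coefficients of vector-valued functions. -/

theorem AnalyticAt.exists_eventuallyEq_sum_add {F : Type*} [NormedAddCommGroup F] [NormedSpace ℂ F]
    {h : ℂ → F} {z₀ : ℂ} (hh : AnalyticAt ℂ h z₀) (m : ℕ) :
    ∃ (c : ℕ → F) (g : ℂ → F), AnalyticAt ℂ g z₀ ∧
      ∀ᶠ z in 𝓝 z₀, h z = (∑ k ∈ Finset.range m, (z - z₀) ^ k • c k) + (z - z₀) ^ m • g z := by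
  induction m generalizing h with
  | zero => exact ⟨0, h, hh, by simp⟩
  | succ m ih =>
    obtain ⟨p, hp⟩ := hh
    obtain ⟨c, g, hg, h1⟩ := ih ⟨_, hp.has_fpower_series_dslope_fslope⟩
    refine ⟨fun k => k.casesOn (h z₀) c, g, hg, h1.mono fun z hz => ?_⟩
    have h2 := sub_smul_dslope h z₀ z
    calc h z = (z - z₀) • dslope h z₀ z + h z₀ := by rw [h2, sub_add_cancel]
      _ = _ := by
        rw [hz, Finset.sum_range_succ']
        simp only [pow_succ', pow_zero, one_smul, mul_smul, ← Finset.smul_sum, smul_add]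
        abel

/-- Letting `z → z₀` isolates `p 0`, which lies in `G` by closedness; subtract it, divide by `z -
z₀` and repeat. Applied to a closed graph, this yields the action of the operator on Laurent
coefficients. -/
theorem Submodule.mem_of_eventually_sum_add_mem {F : Type*} [NormedAddCommGroup F]
    [NormedSpace ℂ F] {G : Submodule ℂ F} (hG : IsClosed (G : Set F)) {z₀ : ℂ} {m : ℕ} {p : ℕ → F}
    {g : ℂ → F} (hg : ContinuousAt g z₀)
    (h : ∀ᶠ z in 𝓝[≠] z₀,
      (∑ k ∈ Finset.range m, (z - z₀) ^ k • p k) + (z - z₀) ^ m • g z ∈ G) :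
    ∀ k < m, p k ∈ G := by
  induction m generalizing p with
  | zero => simp
  | succ m ih =>
    have h0 : p 0 ∈ G := by
      have hc : ContinuousAt (fun z => (∑ k ∈ Finset.range (m + 1), (z - z₀) ^ k • p k)
          + (z - z₀) ^ (m + 1) • g z) z₀ := by fun_prop
      have := hG.mem_of_tendsto (hc.tendsto.mono_left nhdsWithin_le_nhds) h
      simpa [Finset.sum_range_succ'] using this
    have h1 := ih (p := fun k => p (k + 1)) ?_
    · rintro (_ | k) hk
      · exact h0
      · exact h1 k (by omega)
    · filter_upwards [h, self_mem_nhdsWithin] with z hz hne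
      have h2 := G.smul_mem (z - z₀)⁻¹ (sub_mem hz h0)
      convert h2 using 1
      rw [Finset.sum_range_succ']
      simp only [pow_succ', pow_zero, one_smul, mul_smul, ← Finset.smul_sum]
      rw [add_right_comm, add_sub_cancel_right, ← smul_add, inv_smul_smul₀ (sub_ne_zero.2 hne)]

/-- Subtracting the principal part leaves a removable singularity, so Cauchy's theorem applies on
the whole disc although the expansion is only known near `z₀`. Of the principal part only `(z -
z₀)⁻¹` contributes. -/
theorem circleIntegral_eq_of_eventually_eq_sum_add {F : Type*} [NormedAddCommGroup F]
    [NormedSpace ℂ F] [CompleteSpace F] {f g : ℂ → F} {z₀ : ℂ} {r : ℝ} (hr : 0 < r) {n : ℕ}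
    {q : ℕ → F} (hf : ∀ z ∈ Metric.closedBall z₀ r \ {z₀}, DifferentiableAt ℂ f z)
    (hg : ContinuousAt g z₀)
    (h : ∀ᶠ z in 𝓝[≠] z₀,
      f z = (∑ j ∈ Finset.range (n + 1), (z - z₀) ^ (-(j + 1 : ℤ)) • q j) + g z) :
    (2 * Real.pi * Complex.I : ℂ)⁻¹ • (∮ z in C(z₀, r), f z) = q 0 := by
  set S : ℂ → F := fun z => ∑ j ∈ Finset.range (n + 1), (z - z₀) ^ (-(j + 1 : ℤ)) • q j with hS
  have hSd : ∀ z ≠ z₀, DifferentiableAt ℂ S z := by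
    intro z hz
    refine DifferentiableAt.fun_sum fun j _ => ?_
    refine DifferentiableAt.smul_const ?_ _
    exact DifferentiableAt.zpow (by fun_prop) (Or.inl (sub_ne_zero.2 hz))
  have hsph : ∀ z ∈ Metric.sphere z₀ r, z ≠ z₀ := by
    rintro z hz rfl
    simp at hz
    exact hr.ne hz
  have hfi : CircleIntegrable f z₀ r := ContinuousOn.circleIntegrable hr.le fun z hz =>
    (hf z ⟨Metric.sphere_subset_closedBall hz, hsph z hz⟩).continuousAt.continuousWithinAt
  have hterm : ∀ j : ℕ, CircleIntegrable (fun z => (z - z₀) ^ (-(j + 1 : ℤ)) • q j) z₀ r := by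
    intro j
    refine ContinuousOn.circleIntegrable hr.le fun z hz => ContinuousAt.continuousWithinAt ?_
    refine ContinuousAt.smul (ContinuousAt.zpow₀ (by fun_prop) _ ?_) continuousAt_const
    exact Or.inl (sub_ne_zero.2 (hsph z hz))
  have hSi : CircleIntegrable S z₀ r := CircleIntegrable.fun_sum _ fun j _ => hterm j
  have hSint : (∮ z in C(z₀, r), S z) = (2 * Real.pi * Complex.I : ℂ) • q 0 := by
    rw [hS, circleIntegral.integral_fun_sum fun j _ => hterm j, Finset.sum_eq_single 0]
    · rw [circleIntegral.integral_smul_const]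
      simp [hr.ne']
    · intro j _ hj
      rw [circleIntegral.integral_smul_const, circleIntegral.integral_sub_zpow_of_ne (by omega),
        zero_smul]
    · simp
  have hzero : (∮ z in C(z₀, r), (f z - S z)) = 0 := by
    have hlim : Tendsto (fun z => f z - S z) (𝓝[≠] z₀) (𝓝 (g z₀)) := by
      refine (hg.tendsto.mono_left nhdsWithin_le_nhds).congr' (h.mono fun z hz => ?_)
      simp only [hz, hS, add_sub_cancel_left]
    have heq : (∮ z in C(z₀, r), (f z - S z))
        = ∮ z in C(z₀, r), Function.update (fun z => f z - S z) z₀ (g z₀) z :=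
      circleIntegral.integral_congr hr.le fun z hz => by
        simp [Function.update_of_ne (hsph z hz)]
    rw [heq]
    have hd : ∀ z ∈ Metric.closedBall z₀ r \ {z₀},
        DifferentiableAt ℂ (Function.update (fun z => f z - S z) z₀ (g z₀)) z := by
      intro z hz
      refine ((hf z hz).sub (hSd z hz.2)).congr_of_eventuallyEq ?_
      filter_upwards [isOpen_ne.mem_nhds hz.2] with w hw
      simp [Function.update_of_ne hw]
    refine Complex.circleIntegral_eq_zero_of_differentiable_on_off_countable hr.le
      (countable_singleton z₀) (fun z hz => ContinuousAt.continuousWithinAt ?_)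
      fun z hz => hd z ⟨Metric.ball_subset_closedBall hz.1, hz.2⟩
    by_cases hzz : z = z₀
    · subst hzz
      rwa [continuousAt_update_same]
    · exact (hd z ⟨hz, hzz⟩).continuousAt
  rw [circleIntegral.integral_sub hfi hSi, sub_eq_zero] at hzero
  rw [hzero, hSint, inv_smul_smul₀ Complex.two_pi_I_ne_zero]

/-! ### Resolvents of unbounded operators and their Laurent expansion. -/

namespace LinearPMap

variable {E : Type*} [NormedAddCommGroup E] [NormedSpace ℂ E]

theorem isResolventAt_iff {A : E →ₗ.[ℂ] E} {l : ℂ} {R : E →L[ℂ] E} :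
    A.IsResolventAt l R ↔ (∀ z, (R z, l • R z - z) ∈ A.graph) ∧
      ∀ x y, (x, y) ∈ A.graph → R (l • x - y) = x := by
  refine and_congr (forall_congr' fun z => ?_) ?_
  · constructor
    · rintro ⟨h, h'⟩
      rw [mem_graph_iff']
      exact ⟨⟨_, h⟩, Prod.ext rfl (eq_sub_of_add_eq' (sub_eq_iff_eq_add.1 h').symm)⟩
    · intro h
      refine ⟨A.mem_domain_of_mem_graph h, ?_⟩
      rw [A.mem_graph_snd_inj (A.mem_graph ⟨R z, A.mem_domain_of_mem_graph h⟩) h rfl]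
      abel
  · constructor
    · rintro h x y hxy
      obtain ⟨w, hw⟩ := A.mem_graph_iff'.1 hxy
      obtain ⟨rfl, rfl⟩ := Prod.ext_iff.1 hw
      exact h w
    · exact fun h z => h _ _ (A.mem_graph z)

theorem IsResolventAt.eq {A : E →ₗ.[ℂ] E} {l : ℂ} {R R' : E →L[ℂ] E} (h : A.IsResolventAt l R)
    (h' : A.IsResolventAt l R') : R = R' := by
  rw [isResolventAt_iff] at h h'
  ext z
  rw [← h'.2 _ _ (h.1 z), sub_sub_cancel]

theorem isResolventAt_resolvent {A : E →ₗ.[ℂ] E} {l : ℂ} (h : l ∈ A.resolventSet) :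
    A.IsResolventAt l (A.resolvent l) := by
  have h' : ∃ R : E →L[ℂ] E, A.IsResolventAt l R := h
  rw [resolvent, dif_pos h']
  exact h'.choose_spec

theorem IsResolventAt.resolvent_eq {A : E →ₗ.[ℂ] E} {l : ℂ} {R : E →L[ℂ] E}
    (h : A.IsResolventAt l R) : A.resolvent l = R :=
  (isResolventAt_resolvent ⟨R, h⟩).eq h

theorem resolvent_mem_graph {A : E →ₗ.[ℂ] E} {l : ℂ} (h : l ∈ A.resolventSet) (z : E) :
    (A.resolvent l z, l • A.resolvent l z - z) ∈ A.graph :=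
  (isResolventAt_iff.1 (isResolventAt_resolvent h)).1 z

theorem resolvent_apply_of_mem_graph {A : E →ₗ.[ℂ] E} {l : ℂ} (h : l ∈ A.resolventSet) {x y : E}
    (hxy : (x, y) ∈ A.graph) : A.resolvent l (l • x - y) = x :=
  (isResolventAt_iff.1 (isResolventAt_resolvent h)).2 x y hxy

/-- On `D(A)`, `l' - A = (1 + (l' - l) R) (l - A)`. -/
theorem IsResolventAt.mul_inverse {A : E →ₗ.[ℂ] E} {l l' : ℂ} {R : E →L[ℂ] E}
    (h : A.IsResolventAt l R) (hu : IsUnit (1 + (l' - l) • R)) :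
    A.IsResolventAt l' (R * Ring.inverse (1 + (l' - l) • R)) := by
  rw [isResolventAt_iff] at *
  obtain ⟨V, hV⟩ := hu
  rw [← hV, Ring.inverse_unit]
  constructor
  · intro z
    have h1 := h.1 ((↑V⁻¹ : E →L[ℂ] E) z)
    have h2 : (V : E →L[ℂ] E) ((↑V⁻¹ : E →L[ℂ] E) z) = z := by
      rw [← mul_apply_eq_comp, V.mul_inv, one_apply_eq_self]
    rw [hV] at h2
    simp only [_root_.add_apply, _root_.smul_apply,
      one_apply_eq_self] at h2
    rw [mul_apply_eq_comp]
    generalize (↑V⁻¹ : E →L[ℂ] E) z = y at h1 h2 ⊢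
    convert h1 using 2
    rw [← h2]
    module
  · intro x y hxy
    have h1 := h.2 x y hxy
    have h2 : l' • x - y = (V : E →L[ℂ] E) (l • x - y) := by
      rw [hV]
      simp only [_root_.add_apply, _root_.smul_apply,
        one_apply_eq_self, h1]
      module
    rw [h2, mul_apply_eq_comp, ← mul_apply_eq_comp (↑V⁻¹ : E →L[ℂ] E),
      V.inv_mul, one_apply_eq_self, h1]

variable [CompleteSpace E]

theorem eventually_isResolventAt {A : E →ₗ.[ℂ] E} {l : ℂ} {R : E →L[ℂ] E}
    (h : A.IsResolventAt l R) :
    ∀ᶠ l' in 𝓝 l, A.IsResolventAt l' (R * Ring.inverse (1 + (l' - l) • R)) := by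
  have hc : ContinuousAt (fun l' : ℂ => 1 + (l' - l) • R) l := by fun_prop
  have : {V : E →L[ℂ] E | IsUnit V} ∈ 𝓝 (1 + (l - l) • R) := by
    rw [sub_self, zero_smul, add_zero]
    exact Units.isOpen.mem_nhds isUnit_one
  filter_upwards [hc.preimage_mem_nhds this] with l' hl' using h.mul_inverse hl'

theorem isOpen_resolventSet (A : E →ₗ.[ℂ] E) : IsOpen A.resolventSet :=
  isOpen_iff_mem_nhds.2 fun _ ⟨_, hR⟩ => (eventually_isResolventAt hR).mono fun _ h => ⟨_, h⟩

theorem differentiableAt_resolvent {A : E →ₗ.[ℂ] E} {l : ℂ} (hl : l ∈ A.resolventSet) :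
    DifferentiableAt ℂ A.resolvent l := by
  obtain ⟨R, hR⟩ := hl
  have hd : DifferentiableAt ℂ (fun l' : ℂ => R * Ring.inverse (1 + (l' - l) • R)) l := by
    refine DifferentiableAt.const_mul (DifferentiableAt.inverse (by fun_prop) (by simp)) R
  exact hd.congr_of_eventuallyEq ((eventually_isResolventAt hR).mono fun l' h => h.resolvent_eq)

/-- Laurent expansion of the resolvent at a pole, in terms of the spectral projection. -/
theorem exists_laurent {B : E →ₗ.[ℂ] E} (hB : B.IsClosed) {l₀ : ℂ}
    (hmer : MeromorphicAt B.resolvent l₀) {P : E →L[ℂ] E} (hP : B.IsSpectralProjection l₀ P) :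
    ∃ (n : ℕ) (Q : ℕ → E →L[ℂ] E) (g : ℂ → E →L[ℂ] E), AnalyticAt ℂ g l₀ ∧ Q 0 = P ∧
      (∀ k z, (Q k z, l₀ • Q k z + Q (k + 1) z) ∈ B.graph) ∧ (∀ k, n < k → Q k = 0) ∧
      (∀ k, P ∘L Q k = Q k) ∧
      ∀ᶠ l in 𝓝[≠] l₀, B.resolvent l =
        (∑ j ∈ Finset.range (n + 1), (l - l₀) ^ (-(j + 1 : ℤ)) • Q j) + g l := by
  obtain ⟨r, hr, hsub, rfl⟩ := hP
  obtain ⟨n, hn⟩ := hmer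
  -- The extra power ensures that the residue is among the listed coefficients even when `n = 0`.
  have hn1 : AnalyticAt ℂ (fun l => (l - l₀) ^ (n + 1) • B.resolvent l) l₀ := by
    have : AnalyticAt ℂ (fun l => (l - l₀) • ((l - l₀) ^ n • B.resolvent l)) l₀ :=
      AnalyticAt.fun_smul (by fun_prop) hn
    simpa only [smul_smul, ← pow_succ'] using this
  obtain ⟨c, g, hg, hcg⟩ := hn1.exists_eventuallyEq_sum_add (n + 1)
  have hres : ∀ᶠ l in 𝓝[≠] l₀, l ∈ B.resolventSet := by
    filter_upwards [self_mem_nhdsWithin, nhdsWithin_le_nhds (Metric.closedBall_mem_nhds l₀ hr)]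
      with l h1 h2 using hsub ⟨h2, h1⟩
  set Q : ℕ → E →L[ℂ] E := fun k => if k ≤ n then c (n - k) else 0 with hQ
  have hQ0 : ∀ k, n < k → Q k = 0 := fun k hk => if_neg hk.not_ge
  have hlaur : ∀ᶠ l in 𝓝[≠] l₀, B.resolvent l =
        (∑ j ∈ Finset.range (n + 1), (l - l₀) ^ (-(j + 1 : ℤ)) • Q j) + g l := by
    filter_upwards [nhdsWithin_le_nhds hcg, self_mem_nhdsWithin] with l hl hne
    have hne' : l - l₀ ≠ 0 := sub_ne_zero.2 hne
    have hpow : (l - l₀) ^ (n + 1) ≠ 0 := pow_ne_zero _ hne'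
    rw [← inv_smul_smul₀ hpow (B.resolvent l), hl, smul_add, inv_smul_smul₀ hpow,
      ← Finset.sum_range_reflect, Finset.smul_sum]
    congr 1
    refine Finset.sum_congr rfl fun j hj => ?_
    have hj' : j ≤ n := Nat.lt_succ_iff.1 (Finset.mem_range.1 hj)
    rw [hQ, smul_smul]
    simp only [if_pos hj', Nat.add_sub_cancel]
    congr 1
    rw [← zpow_natCast, ← zpow_natCast, ← zpow_neg, ← zpow_add₀ hne']
    congr 1
    push_cast [hj']
    ring
  -- the shifted graph
  set G : Submodule ℂ (E × E) := B.graph.comap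
    ((LinearMap.fst ℂ E E).prod (l₀ • LinearMap.fst ℂ E E + LinearMap.snd ℂ E E)) with hGdef
  have hG : _root_.IsClosed (G : Set (E × E)) := by
    refine IsClosed.preimage (f := fun p : E × E => (p.1, l₀ • p.1 + p.2)) (by fun_prop) hB
  -- Expand `(l - l₀) ^ (n + 1) • (R z, (l - l₀) R z - z)`, a point of `G`. The factor `l - l₀`
  -- shifts the coefficients by one, and the term with `z` has order `n + 1`, so it falls into the
  -- remainder.
  have hcoef : ∀ z, ∀ k < n + 1, (c k z, (if k = 0 then 0 else c (k - 1)) z) ∈ G := by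
    intro z
    refine Submodule.mem_of_eventually_sum_add_mem hG (z₀ := l₀)
      (p := fun k => (c k z, (if k = 0 then 0 else c (k - 1)) z))
      (g := fun l => (g l z, c n z + (l - l₀) • g l z - z)) ?_ ?_
    · have := hg.continuousAt
      fun_prop
    · filter_upwards [nhdsWithin_le_nhds hcg, hres] with l hl hl'
      have h1 := B.graph.smul_mem ((l - l₀) ^ (n + 1)) (resolvent_mem_graph hl' z)
      have h2 := DFunLike.congr_fun hl z
      simp only [_root_.add_apply, _root_.sum_apply,
        _root_.smul_apply] at h2
      rw [hGdef, Submodule.mem_comap]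
      convert h1 using 1
      refine Prod.ext ?_ ?_
      · simp [Prod.fst_sum, h2]
      · simp only [LinearMap.prod_apply, Function.prod_apply, LinearMap.fst_apply,
          LinearMap.snd_apply, LinearMap.add_apply, LinearMap.smul_apply, Prod.fst_add,
          Prod.snd_add, Prod.fst_sum, Prod.snd_sum, Prod.smul_fst, Prod.smul_snd]
        rw [← h2]
        have h3 : ∑ k ∈ Finset.range (n + 1),
            (l - l₀) ^ k • (if k = 0 then (0 : E →L[ℂ] E) else c (k - 1)) z
            + (l - l₀) ^ (n + 1) • c n z
            = (l - l₀) • ∑ k ∈ Finset.range (n + 1), (l - l₀) ^ k • c k z := by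
          have := Finset.sum_range_succ
            (fun k => (l - l₀) ^ k • (if k = 0 then (0 : E →L[ℂ] E) else c (k - 1)) z) (n + 1)
          simp only [Nat.add_eq_zero_iff, one_ne_zero, and_false, if_false,
            Nat.add_sub_cancel] at this
          rw [← this, Finset.sum_range_succ']
          simp [Finset.smul_sum, pow_succ', mul_smul]
        rw [← eq_sub_iff_add_eq] at h3
        rw [h3, ← sub_eq_iff_eq_add.2 h2]
        module
  have hgraph : ∀ k z, (Q k z, l₀ • Q k z + Q (k + 1) z) ∈ B.graph := by
    intro k z
    rcases lt_or_ge n k with hk | hk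
    · rw [hQ0 k hk, hQ0 (k + 1) (by omega)]
      simp
    · have h1 : (_, _) ∈ B.graph := hcoef z (n - k) (by omega)
      have h2 : Q k = c (n - k) := if_pos hk
      have h3 : Q (k + 1) = if n - k = 0 then 0 else c (n - k - 1) := by
        by_cases h : n - k = 0
        · rw [if_pos h, hQ0 _ (by omega)]
        · rw [if_neg h]
          exact if_pos (by omega)
      rw [h2, h3]
      exact h1
  have hP := circleIntegral_eq_of_eventually_eq_sum_add hr
    (fun l hl => differentiableAt_resolvent (hsub hl)) hg.continuousAt hlaur
  refine ⟨n, Q, g, hg, hP.symm, hgraph, hQ0, fun k => ?_, hlaur⟩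
  -- Applying `l - B` to the right-hand side telescopes to `Q k`. The residue of this sum is `Q k`,
  -- which gives `P Q k = Q k` with a single contour.
  have hmul : ∀ l ∈ B.resolventSet, l ≠ l₀ → B.resolvent l ∘L Q k =
      ∑ j ∈ Finset.range (n + 1), (l - l₀) ^ (-(j + 1 : ℤ)) • Q (k + j) := by
    intro l hl hne
    have hne' : l - l₀ ≠ 0 := sub_ne_zero.2 hne
    ext z
    have h1 := B.graph.sum_mem (t := Finset.range (n + 1)) fun j _ =>
      B.graph.smul_mem ((l - l₀) ^ (-(j + 1 : ℤ))) (hgraph (k + j) z)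
    replace h1 : (∑ j ∈ Finset.range (n + 1), (l - l₀) ^ (-(j + 1 : ℤ)) • Q (k + j) z,
        ∑ j ∈ Finset.range (n + 1), (l - l₀) ^ (-(j + 1 : ℤ)) •
          (l₀ • Q (k + j) z + Q (k + j + 1) z)) ∈ B.graph := by
      convert h1 using 1
      ext <;> simp [Prod.fst_sum, Prod.snd_sum]
    have h2 := resolvent_apply_of_mem_graph hl h1
    simp only [ContinuousLinearMap.comp_apply, _root_.sum_apply,
      _root_.smul_apply]
    rw [← h2]
    congr 1
    rw [Finset.smul_sum, ← Finset.sum_sub_distrib]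
    have h3 := Finset.sum_range_sub' (fun j : ℕ => (l - l₀) ^ (-(j : ℤ)) • Q (k + j) z) (n + 1)
    rw [hQ0 (k + (n + 1)) (by omega)] at h3
    simp only [Nat.cast_zero, neg_zero, zpow_zero, one_smul, add_zero,
      _root_.zero_apply, smul_zero, sub_zero] at h3
    rw [← h3]
    refine Finset.sum_congr rfl fun j _ => ?_
    have h4 : (l - l₀) ^ (-(j : ℤ)) = (l - l₀) * (l - l₀) ^ (-(j + 1 : ℤ)) := by
      rw [← zpow_one_add₀ hne']
      congr 1
      ring
    rw [h4]
    push_cast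
    rw [add_assoc k j 1]
    module
  have hPk := circleIntegral_eq_of_eventually_eq_sum_add (f := fun l => B.resolvent l ∘L Q k)
    (g := 0) (q := fun j => Q (k + j)) (n := n) hr
    (fun l hl => (differentiableAt_resolvent (hsub hl)).clm_comp (differentiableAt_const _))
    continuousAt_const (by
      filter_upwards [hres, self_mem_nhdsWithin] with l hl hne
      simp [hmul l hl hne])
  refine Eq.trans ?_ hPk
  have hint : CircleIntegrable B.resolvent l₀ r :=
    ContinuousOn.circleIntegrable hr.le fun l hl => by
      refine (differentiableAt_resolvent (hsub ⟨Metric.sphere_subset_closedBall hl,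
        ?_⟩)).continuousAt.continuousWithinAt
      rintro rfl
      simp [hr.ne] at hl
  have hcomm := ContinuousLinearMap.intervalIntegral_comp_comm
    ((ContinuousLinearMap.compL ℂ E E E).flip (Q k)) hint.out
  simp only [ContinuousLinearMap.flip_apply, ContinuousLinearMap.compL_apply,
    ContinuousLinearMap.smul_comp] at hcomm
  rw [circleIntegral, circleIntegral, hcomm, ContinuousLinearMap.smul_comp]

end LinearPMap


/-! ### Strong positivity of the spectral projection and simplicity of the pole. -/

namespace ComplexBanachLattice

variable {X E : Type*}
  [NormedAddCommGroup X] [Lattice X] [IsOrderedAddMonoid X] [HasSolidNorm X]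
  [NormedSpace ℝ X] [IsOrderedModule ℝ X] [CompleteSpace X]
  [NormedAddCommGroup E] [NormedSpace ℂ E] [CompleteSpace E] [ComplexBanachLattice X E]

/-- The imaginary part of the solution is annihilated by `l - A`, hence zero. -/
theorem IsRealOperator.im_resolvent_ofReal {A : E →ₗ.[ℂ] E} (hA : IsRealOperator X A) {l : ℝ}
    (hl : (l : ℂ) ∈ A.resolventSet) (x : X) : im X (A.resolvent l (ofReal x : E)) = 0 := by
  have h1 := (hA.ofReal_mem_graph (LinearPMap.resolvent_mem_graph hl (ofReal x))).2
  simp only [Complex.coe_smul, map_sub, map_smul, im_ofReal, sub_zero] at h1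
  have h2 := LinearPMap.resolvent_apply_of_mem_graph hl h1
  rw [Complex.coe_smul, sub_self, map_zero] at h2
  exact ofReal_injective (E := E) (by rw [← h2, map_zero])

theorem smul_le_re_of_succeq {P : E →L[ℂ] E} {u : X}
    (hPu : ∀ f : E, RealLE X 0 f → f ≠ 0 → Succeq X (P f) (ofReal u)) {x : X} (hx : 0 ≤ x)
    (hx0 : x ≠ 0) : im X (P (ofReal x)) = 0 ∧ ∃ c : ℝ, 0 < c ∧ c • u ≤ re X (P (ofReal x)) := by
  have h := hPu (ofReal x) ⟨0, x, by simp, rfl, hx⟩ (by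
    rw [← map_zero (ofReal : X →ₗ[ℝ] E)]
    exact ofReal_injective.ne hx0)
  obtain ⟨y, hy⟩ := h.1
  rw [← hy, succeq_ofReal_iff] at h
  rw [← hy]
  simpa using h

theorem im_apply_ofReal_eq_zero {P : E →L[ℂ] E} {u : X}
    (hPu : ∀ f : E, RealLE X 0 f → f ≠ 0 → Succeq X (P f) (ofReal u)) (x : X) :
    im X (P (ofReal x)) = 0 := by
  have h : ∀ y : X, 0 ≤ y → im X (P (ofReal y)) = 0 := by
    intro y hy
    by_cases h0 : y = 0
    · simp [h0]
    · exact (smul_le_re_of_succeq hPu hy h0).1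
  rw [← posPart_sub_negPart x, map_sub, map_sub, map_sub, h _ (posPart_nonneg x),
    h _ (negPart_nonneg x), sub_zero]

/-- If `P f ≽ u` for all `f > 0` and `P w = w ≽ u`, then the fixed space of `P` inside `E_u` is
spanned by `w`. -/
theorem eq_smul_of_fixed {P : E →L[ℂ] E} {u w : X} (hu : 0 ≤ u) (hu0 : u ≠ 0)
    (hPu : ∀ f : E, RealLE X 0 f → f ≠ 0 → Succeq X (P f) (ofReal u))
    (hw : P (ofReal w) = ofReal w) {c : ℝ} (hc : 0 < c) (hcw : c • u ≤ w)
    (hwu : (ofReal w : E) ∈ principalIdeal X (ofReal u : E)) {x : X}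
    (hx : P (ofReal x) = ofReal x) (hxu : (ofReal x : E) ∈ principalIdeal X (ofReal u : E)) :
    ∃ t : ℝ, x = t • w := by
  obtain ⟨n, hn⟩ := (mem_principalIdeal_iff hu).1 hxu
  have hw0 : 0 ≤ w := (smul_nonneg hc.le hu).trans hcw
  have hwne : w ≠ 0 := by
    rintro rfl
    exact hu0 (le_antisymm (by simpa using (le_inv_smul_iff_of_pos hc).2 hcw) hu)
  have huw : u ≤ c⁻¹ • w := by
    rwa [le_inv_smul_iff_of_pos hc]
  have hxle : x ≤ (n * c⁻¹ : ℝ) • w := by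
    have h1 := re_le_modulus (X := X) (ofReal x : E)
    rw [re_ofReal] at h1
    rw [mul_smul]
    exact (h1.trans hn).trans (smul_le_smul_of_nonneg_left huw (by positivity))
  have hxge : (-(n * c⁻¹) : ℝ) • w ≤ x := by
    have h1 := neg_re_le_modulus (X := X) (ofReal x : E)
    rw [re_ofReal] at h1
    rw [neg_smul, neg_le, mul_smul]
    exact (h1.trans hn).trans (smul_le_smul_of_nonneg_left huw (by positivity))
  obtain ⟨m, hm⟩ := (mem_principalIdeal_iff hu).1 hwu
  have hwm : w ≤ ((m : ℝ) + 1) • u := by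
    have h1 := (re_le_modulus (X := X) (ofReal w : E)).trans hm
    rw [re_ofReal] at h1
    exact h1.trans (smul_le_smul_of_nonneg_right (by linarith) hu)
  -- `S` is closed and bounded above, so its supremum gives the largest multiple of `w` below `x`.
  set S : Set ℝ := {t | t • w ≤ x} with hS
  have hSb : BddAbove S := by
    refine ⟨n * c⁻¹, fun t ht => ?_⟩
    by_contra! hlt
    have h1 : (t - n * c⁻¹) • w ≤ 0 := by
      rw [sub_smul, sub_nonpos]
      exact le_trans ht hxle
    have h2 := le_antisymm h1 (smul_nonneg (sub_nonneg.2 hlt.le) hw0)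
    exact (smul_ne_zero (sub_ne_zero.2 hlt.ne') hwne) h2
  have hSc : IsClosed S := isClosed_le (by fun_prop) continuous_const
  have hmem : sSup S • w ≤ x := hSc.csSup_mem ⟨_, hxge⟩ hSb
  refine ⟨sSup S, by_contra fun hne => ?_⟩
  obtain ⟨-, d, hd, hdu⟩ := smul_le_re_of_succeq hPu (sub_nonneg.2 hmem) (sub_ne_zero.2 hne)
  have hfix : P (ofReal (x - sSup S • w)) = ofReal (x - sSup S • w) := by
    rw [map_sub, map_sub, map_smul, P.map_smul_of_tower, hw, hx]
  rw [hfix, re_ofReal] at hdu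
  have h1 : (d * ((m : ℝ) + 1)⁻¹) • w ≤ x - sSup S • w := by
    refine le_trans ?_ hdu
    rw [mul_smul]
    exact smul_le_smul_of_nonneg_left ((inv_smul_le_iff_of_pos (by positivity)).2 hwm) hd.le
  have h2 : sSup S + d * ((m : ℝ) + 1)⁻¹ ∈ S := by
    change _ • w ≤ x
    rw [add_smul]
    exact le_sub_iff_add_le'.1 h1
  have h3 := le_csSup hSb h2
  have h4 : 0 < d * ((m : ℝ) + 1)⁻¹ := by positivity
  linarith

/-- Under the strong positivity assumption on the spectral projection, the pole is simple. -/
theorem exists_resolvent_eq_simple {B : E →ₗ.[ℂ] E} (hB : B.IsClosed) {l₀ : ℂ}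
    (hmer : MeromorphicAt B.resolvent l₀) {P : E →L[ℂ] E} (hP : B.IsSpectralProjection l₀ P)
    {u : X} (hu : 0 ≤ u) (hu0 : u ≠ 0)
    (hdom : (B.domain : Set E) ⊆ principalIdeal X (ofReal u : E))
    (hPu : ∀ f : E, RealLE X 0 f → f ≠ 0 → Succeq X (P f) (ofReal u)) :
    ∃ g : ℂ → E →L[ℂ] E, ContinuousAt g l₀ ∧ (∀ z, (P z, l₀ • P z) ∈ B.graph) ∧
      ∀ᶠ l in 𝓝[≠] l₀, B.resolvent l = (l - l₀)⁻¹ • P + g l := by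
  obtain ⟨n, Q, g, hg, hQP, hgraph, hQn, hPQ, hlaur⟩ := B.exists_laurent hB hmer hP
  have hPP : ∀ k z, P (Q k z) = Q k z := fun k z => DFunLike.congr_fun (hPQ k) z
  have hPP0 : ∀ z, P (P z) = P z := fun z => by simpa [hQP] using hPP 0 z
  have hran : ∀ z, P z ∈ principalIdeal X (ofReal u : E) := fun z =>
    hdom (B.mem_domain_of_mem_graph (hQP ▸ hgraph 0 z))
  obtain ⟨him, c, hc, hcw⟩ := smul_le_re_of_succeq hPu hu hu0
  set w : X := re X (P (ofReal u)) with hwdef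
  have hwP : (ofReal w : E) = P (ofReal u) := ofReal_re_of_im_eq_zero him
  have hw : P (ofReal w) = ofReal w := by rw [hwP, hPP0]
  have hwne : (ofReal w : E) ≠ 0 := by
    intro h
    obtain h0 : w = 0 := ofReal_injective (E := E) (by rw [h, map_zero])
    rw [h0] at hcw
    exact hu0 (le_antisymm (by simpa using (le_inv_smul_iff_of_pos hc).2 hcw) hu)
  have hwu : (ofReal w : E) ∈ principalIdeal X (ofReal u : E) := hwP ▸ hran _
  have hspan_real : ∀ x : X, P (ofReal x) = ofReal x → ∃ t : ℝ, x = t • w := fun x hx =>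
    eq_smul_of_fixed hu hu0 hPu hw hc hcw hwu hx (hx ▸ hran _)
  have hspan : ∀ z, P z = z → ∃ a : ℂ, z = a • (ofReal w : E) := by
    intro z hz
    have h1 : (ofReal (re X (P (ofReal (re X z)))) : E) +
        Complex.I • ofReal (re X (P (ofReal (im X z)))) = ofReal (re X z) +
        Complex.I • ofReal (im X z) := by
      rw [ofReal_re_of_im_eq_zero (im_apply_ofReal_eq_zero hPu _),
        ofReal_re_of_im_eq_zero (im_apply_ofReal_eq_zero hPu _), ← map_smul, ← map_add,
        re_add_im, hz]
    obtain ⟨h2, h3⟩ := mk_inj h1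
    obtain ⟨s, hs⟩ := hspan_real (re X z) (by
      rw [← ofReal_re_of_im_eq_zero (im_apply_ofReal_eq_zero hPu _), h2])
    obtain ⟨t, ht⟩ := hspan_real (im X z) (by
      rw [← ofReal_re_of_im_eq_zero (im_apply_ofReal_eq_zero hPu _), h3])
    refine ⟨s + Complex.I * t, ?_⟩
    rw [← re_add_im (X := X) z, hs, ht, map_smul, map_smul, add_smul, mul_smul, Complex.coe_smul,
      Complex.coe_smul]
  -- `w` is an eigenvector of the nilpotent part
  obtain ⟨a, ha⟩ := hspan _ (hPP 1 (ofReal w))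
  have hgw : ((ofReal w : E), l₀ • (ofReal w : E) + a • (ofReal w : E)) ∈ B.graph := by
    have := hgraph 0 (ofReal w)
    rwa [hQP, hw, zero_add, ha] at this
  have hpow : ∀ k, Q k (ofReal w) = a ^ k • (ofReal w : E) := by
    intro k
    induction k with
    | zero => rw [hQP, hw, pow_zero, one_smul]
    | succ k ih =>
      have h1 := hgraph k (ofReal w)
      have h2 := B.graph.smul_mem (a ^ k) hgw
      rw [ih] at h1
      have h3 := B.mem_graph_snd_inj h1 h2 rfl
      rw [smul_add, smul_comm, add_right_inj, smul_smul, ← pow_succ] at h3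
      exact h3
  -- `Q (n + 1) = 0` forces `a ^ (n + 1) = 0`.
  have ha0 : a = 0 := by
    have h1 := hpow (n + 1)
    rw [hQn _ (Nat.lt_succ_self n), _root_.zero_apply, eq_comm, smul_eq_zero] at h1
    exact eq_zero_of_pow_eq_zero (h1.resolve_right hwne)
  rw [ha0, zero_smul, add_zero] at hgw
  have hPgraph : ∀ z, (P z, l₀ • P z) ∈ B.graph := by
    intro z
    obtain ⟨b, hb⟩ := hspan _ (hPP0 z)
    rw [hb, smul_comm]
    exact B.graph.smul_mem b hgw
  have hQ1 : ∀ k, Q (k + 1) = 0 := by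
    intro k
    induction k with
    | zero =>
      ext z
      have h1 := hgraph 0 z
      rw [hQP] at h1
      simpa using B.mem_graph_snd_inj h1 (hPgraph z) rfl
    | succ k ih =>
      ext z
      have h1 := hgraph (k + 1) z
      rw [ih] at h1
      simpa using B.mem_graph_snd_inj h1 B.graph.zero_mem rfl
  refine ⟨g, hg.continuousAt, hPgraph, hlaur.mono fun l hl => ?_⟩
  rw [hl, Finset.sum_range_succ', hQP]
  simp [hQ1]

/-- Write `x l = R(l₁, A) (l₁ x l - y l)` with `l₁` fixed: the resolvent is gauge-bounded and its
argument is norm-bounded near `l₀`. -/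
theorem eventually_modulus_le_of_mem_graph {A : E →ₗ.[ℂ] E} {l₁ : ℂ} (hl₁ : l₁ ∈ A.resolventSet)
    {u : X} (hu : 0 ≤ u) (hdom : (A.domain : Set E) ⊆ principalIdeal X (ofReal u : E)) {l₀ : ℂ}
    {L : Filter ℂ} (hL : L ≤ 𝓝 l₀) {x y : ℂ → E} (hx : ContinuousAt x l₀) (hy : ContinuousAt y l₀)
    (hxy : ∀ᶠ l in L, (x l, y l) ∈ A.graph) :
    ∃ C : ℝ, ∀ᶠ l in L, modulus (x l) ≤ C • u := by
  obtain ⟨C, hC, h⟩ := exists_modulus_le_of_range_subset hu (A.resolvent l₁) fun z =>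
    hdom (A.mem_domain_of_mem_graph (LinearPMap.resolvent_mem_graph hl₁ z))
  have hc : ContinuousAt (fun l => ‖l₁ • x l - y l‖) l₀ := by fun_prop
  refine ⟨C * (‖l₁ • x l₀ - y l₀‖ + 1), ?_⟩
  filter_upwards [hxy, hL (hc.eventually_lt_const (lt_add_one _))] with l h1 h2
  rw [← LinearPMap.resolvent_apply_of_mem_graph hl₁ h1]
  exact (h _).trans (smul_le_smul_of_nonneg_right (by gcongr) hu)

end ComplexBanachLattice


/-! ### Estimates by multiples of `u` near `l₀`, and the theorem. -/

namespace ComplexBanachLattice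

variable {X E : Type*}
  [NormedAddCommGroup X] [Lattice X] [IsOrderedAddMonoid X] [HasSolidNorm X]
  [NormedSpace ℝ X] [IsOrderedModule ℝ X] [CompleteSpace X]
  [NormedAddCommGroup E] [NormedSpace ℂ E] [CompleteSpace E] [ComplexBanachLattice X E]

/-- The ideal generated by `0` is `{0}`, which is not dense once `E ≠ 0`. -/
theorem ne_zero_of_dense_subset_principalIdeal {S : Set E} (hS : Dense S) {u : X}
    (h : S ⊆ principalIdeal X (ofReal u : E)) {f : E} (hf : f ≠ 0) : u ≠ 0 := by
  rintro rfl
  have h0 : S ⊆ {0} := fun z hz => by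
    obtain ⟨n, hn⟩ := (mem_principalIdeal_iff le_rfl).1 (h hz)
    rw [smul_zero] at hn
    exact modulus_eq_zero_iff.1 (le_antisymm hn (modulus_nonneg z))
  exact hf (by simpa using closure_mono h0 (hS f))

/-- Near a simple pole the resolvent on a positive vector is, up to a multiple of `u`,
`(l - l₀)⁻¹ P`. -/
theorem exists_eventually_abs_resolvent_sub_le {B : E →ₗ.[ℂ] E} (hB : B.IsClosed)
    (hreal : IsRealOperator X B) {l₀ : ℝ} (hpole : B.IsPoleOfResolvent l₀) {P : E →L[ℂ] E}
    (hP : B.IsSpectralProjection l₀ P) {u : X} (hu : 0 ≤ u) (hu0 : u ≠ 0)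
    (hdom : (B.domain : Set E) ⊆ principalIdeal X (ofReal u : E))
    (hPu : ∀ f : E, RealLE X 0 f → f ≠ 0 → Succeq X (P f) (ofReal u)) (x : X) :
    ∃ C : ℝ, ∀ᶠ l : ℝ in 𝓝[≠] l₀, (l : ℂ) ∈ B.resolventSet ∧
      ∃ y : X, B.resolvent l (ofReal x : E) = ofReal y ∧
        |y - (l - l₀)⁻¹ • re X (P (ofReal x))| ≤ C • u := by
  obtain ⟨g, hg, hPg, hlaur⟩ := exists_resolvent_eq_simple hB hpole.2.1 hP hu hu0 hdom hPu
  obtain ⟨l₁, hl₁⟩ := hpole.1.exists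
  obtain ⟨C, hC⟩ := eventually_modulus_le_of_mem_graph hl₁ hu hdom
    (nhdsWithin_le_nhds (s := {(l₀ : ℂ)}ᶜ))
    -- This `y` is `B (g l x)`: since `B P = l₀ P`, the singular terms combine to `P x`, leaving a
    -- function continuous at `l₀`.
    (x := fun l => g l (ofReal x)) (y := fun l => l • g l (ofReal x) - ofReal x + P (ofReal x))
    (by fun_prop) (by fun_prop) (by
      filter_upwards [hpole.1, hlaur, self_mem_nhdsWithin] with l h1 h2 hne
      have h3 := sub_mem (LinearPMap.resolvent_mem_graph h1 (ofReal x : E))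
        (B.graph.smul_mem (l - l₀)⁻¹ (hPg (ofReal x)))
      rw [h2] at h3
      convert h3 using 1
      refine Prod.ext ?_ ?_
      · simp
      · have h4 : P (ofReal x) = ((l - l₀) * (l - l₀)⁻¹) • P (ofReal x : E) := by
          rw [mul_inv_cancel₀ (sub_ne_zero.2 hne), one_smul]
        simp only [_root_.add_apply, _root_.smul_apply, Prod.smul_mk, Prod.mk_sub_mk]
        nth_rw 1 [h4]
        module)
  have htend : Tendsto (fun l : ℝ => (l : ℂ)) (𝓝[≠] l₀) (𝓝[≠] (l₀ : ℂ)) :=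
    (Complex.continuous_ofReal.continuousAt).tendsto.inf
      (tendsto_principal_principal.2 fun l hl => by simpa using hl)
  refine ⟨C, ?_⟩
  filter_upwards [htend.eventually hpole.1, htend.eventually hlaur, htend.eventually hC]
    with l h1 h2 h3
  refine ⟨h1, _, (ofReal_re_of_im_eq_zero (hreal.im_resolvent_ofReal h1 x)).symm, ?_⟩
  have h4 : re X (B.resolvent l (ofReal x : E)) - (l - l₀)⁻¹ • re X (P (ofReal x))
      = re X (g l (ofReal x)) := by
    rw [h2, _root_.add_apply, _root_.smul_apply, ← Complex.ofReal_sub, ← Complex.ofReal_inv,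
      Complex.coe_smul, map_add, map_smul, add_sub_cancel_left]
  rw [h4]
  exact (abs_re_le_modulus _).trans h3

theorem exists_eventually_modulus_resolvent_le {A : E →ₗ.[ℂ] E} {l₀ : ℂ}
    (hl₀ : l₀ ∈ A.resolventSet) {u : X} (hu : 0 ≤ u)
    (hdom : (A.domain : Set E) ⊆ principalIdeal X (ofReal u : E)) (f : E) :
    ∃ C : ℝ, ∀ᶠ l in 𝓝 l₀, l ∈ A.resolventSet ∧ modulus (A.resolvent l f) ≤ C • u := by
  have hc := (LinearPMap.differentiableAt_resolvent hl₀).continuousAt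
  have hev : ∀ᶠ l in 𝓝 l₀, l ∈ A.resolventSet := A.isOpen_resolventSet.mem_nhds hl₀
  obtain ⟨C, hC⟩ := eventually_modulus_le_of_mem_graph hl₀ hu hdom le_rfl
    (x := fun l => A.resolvent l f) (y := fun l => l • A.resolvent l f - f)
    (by fun_prop) (by fun_prop) (hev.mono fun l hl => LinearPMap.resolvent_mem_graph hl f)
  exact ⟨C, hev.and hC⟩

end ComplexBanachLattice

open ComplexBanachLattice

theorem mainTheorem1 {X E : Type*}
    [NormedAddCommGroup X] [Lattice X] [IsOrderedAddMonoid X] [HasSolidNorm X]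
    [NormedSpace ℝ X] [IsOrderedModule ℝ X] [CompleteSpace X]
    [NormedAddCommGroup E] [NormedSpace ℂ E] [CompleteSpace E] [ComplexBanachLattice X E]
    (A B : E →ₗ.[ℂ] E)
    (hA_closed : A.IsClosed) (hA_dense : Dense (A.domain : Set E))
    (hA_real : ComplexBanachLattice.IsRealOperator X A)
    (hB_closed : B.IsClosed) (hB_dense : Dense (B.domain : Set E))
    (hB_real : ComplexBanachLattice.IsRealOperator X B)
    (u : E) (hu : ComplexBanachLattice.RealLE X 0 u)
    (l₀ : ℝ) (hl₀_spec : (l₀ : ℂ) ∈ B.spectrum) (hl₀_pole : B.IsPoleOfResolvent l₀)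
    (hA_dom : (A.domain : Set E) ⊆ ComplexBanachLattice.principalIdeal X u)
    (hB_dom : (B.domain : Set E) ⊆ ComplexBanachLattice.principalIdeal X u)
    (P : E →L[ℂ] E) (hP : B.IsSpectralProjection l₀ P)
    (hPu : ∀ f : E, ComplexBanachLattice.RealLE X 0 f → f ≠ 0 →
      ComplexBanachLattice.Succeq X (P f) u)
    (hl₀_A : (l₀ : ℂ) ∈ A.resolventSet)
    (f : E) (hf : f ≠ 0) :
    (∀ᶠ l : ℝ in 𝓝[>] l₀, (l : ℂ) ∈ A.resolventSet ∧ (l : ℂ) ∈ B.resolventSet ∧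
      ComplexBanachLattice.Succeq X
        (B.resolvent l (ComplexBanachLattice.abs X f)
          - ComplexBanachLattice.abs X (A.resolvent l f)) u) ∧
    (∀ᶠ m : ℝ in 𝓝[<] l₀, (m : ℂ) ∈ A.resolventSet ∧ (m : ℂ) ∈ B.resolventSet ∧
      ComplexBanachLattice.Preceq X
        (B.resolvent m (ComplexBanachLattice.abs X f)
          + ComplexBanachLattice.abs X (A.resolvent m f)) (-u)) := by
  obtain ⟨v, u, hv, rfl, hvu⟩ := hu
  obtain rfl : v = 0 := ofReal_injective (E := E) (by rw [← hv, map_zero])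
  have hu0 := ne_zero_of_dense_subset_principalIdeal hB_dense hB_dom hf
  obtain ⟨CA, hCA⟩ := exists_eventually_modulus_resolvent_le hl₀_A hvu hA_dom f
  obtain ⟨CB, hCB⟩ := exists_eventually_abs_resolvent_sub_le hB_closed hB_real hl₀_pole hP hvu hu0
    hB_dom hPu (modulus f)
  obtain ⟨-, c, hc, hcu⟩ := smul_le_re_of_succeq hPu (modulus_nonneg (X := X) f)
    (modulus_eq_zero_iff.not.2 hf)
  replace hCA := (Complex.continuous_ofReal.tendsto l₀).eventually hCA
  -- The leading term must absorb `CA u` and `CB u` and leave one copy of `u`; hence the constant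
  -- `1` in both conclusions.
  have hsmall : ∀ᶠ l : ℝ in 𝓝 l₀, |l - l₀| * (CA + CB + 1) < c := by
    have hcont : Continuous fun l : ℝ => |l - l₀| * (CA + CB + 1) := by fun_prop
    exact hcont.continuousAt.eventually_lt_const (by simpa using hc)
  have hlt : ∀ l : ℝ, l ≠ l₀ → |l - l₀| * (CA + CB + 1) < c →
      CA + CB + 1 ≤ |l - l₀|⁻¹ * c := fun l hl h => by
    rw [inv_mul_eq_div, le_div_iff₀ (abs_pos.2 (sub_ne_zero.2 hl)), mul_comm]
    exact h.le
  constructor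
  · filter_upwards [nhdsWithin_le_nhds hCA, nhdsWithin_mono _ (fun _ h => ne_of_gt h) hCB,
      nhdsWithin_le_nhds hsmall, self_mem_nhdsWithin] with l hA hB hl hgt
    obtain ⟨hB, y, hy, hyu⟩ := hB
    refine ⟨hA.1, hB, ?_⟩
    have h1 := hlt l (ne_of_gt hgt) hl
    have h0 : (0 : ℝ) ≤ (l - l₀)⁻¹ := inv_nonneg.2 (sub_nonneg.2 (le_of_lt hgt))
    rw [abs_of_pos (sub_pos.2 hgt)] at h1
    change Succeq X (B.resolvent l (ofReal (modulus f : X) : E) -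
      ofReal (modulus (A.resolvent l f))) _
    rw [hy, ← map_sub, succeq_ofReal_iff]
    refine ⟨1, one_pos, ?_⟩
    have h2 := smul_le_smul_of_nonneg_right h1 hvu
    have h3 := smul_le_smul_of_nonneg_left hcu h0
    have h4 := neg_le.1 (abs_le'.1 hyu).2
    rw [mul_smul, add_smul, add_smul] at h2
    have h5 := add_le_add (h2.trans h3) (sub_le_sub h4 hA.2)
    rw [← sub_nonneg] at h5 ⊢
    convert h5 using 1
    abel
  · filter_upwards [nhdsWithin_le_nhds hCA, nhdsWithin_mono _ (fun _ h => ne_of_lt h) hCB,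
      nhdsWithin_le_nhds hsmall, self_mem_nhdsWithin] with l hA hB hl hgt
    obtain ⟨hB, y, hy, hyu⟩ := hB
    refine ⟨hA.1, hB, ?_⟩
    have h1 := hlt l (ne_of_lt hgt) hl
    -- To the left of `l₀` the leading term is negative, so its upper estimate is used.
    have h0 : (0 : ℝ) ≤ (-(l - l₀))⁻¹ :=
      inv_nonneg.2 (neg_nonneg.2 (sub_nonpos.2 (le_of_lt hgt)))
    rw [abs_of_neg (sub_neg.2 hgt)] at h1
    change Succeq X _ (B.resolvent l (ofReal (modulus f : X) : E) +
      ofReal (modulus (A.resolvent l f)))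
    rw [hy, ← map_add, ← map_neg, succeq_ofReal_iff]
    refine ⟨1, one_pos, ?_⟩
    have h2 := smul_le_smul_of_nonneg_right h1 hvu
    have h3 := smul_le_smul_of_nonneg_left hcu h0
    have h4 := (abs_le'.1 hyu).1
    rw [mul_smul, add_smul, add_smul] at h2
    have h5 := add_le_add (h2.trans h3) (add_le_add h4 hA.2)
    rw [inv_neg, neg_smul] at h5
    rw [← sub_nonneg] at h5 ⊢
    convert h5 using 1
    module
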